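/- An \emph{operadic tree} is a diagram of finite sets $A \xleftarrow{s} M \xrightarrow{p} N \xrightarrow{t} A$ ($A$ = edges, $N$ = nodes, $M$ = nodes with a marked input edge) such that $t$ is injective, $s$ is injective with singleton complement (the \emph{root edge}), and every edge reaches the root under iterating the map $\sigma\colon A\to A$ that fixes the root and sends $s(m)\mapsto t(p(m))$. Leaves are the edges not in the image of $t$; isomorphisms are isomorphisms of diagrams. A \emph{cut} of a tree $T$ is a subtree $S\subseteq T$ containing the root edge and containing, with each of its nodes, all edges incident to that node. For a cut $c: S\subseteq T$, let $P_c$ be the forest consisting, for each leaf $e$ of $S$, of the ideal subtree of $T$ generated by $e$ (the tree with root $e$ consisting of everything in $T$ above $e$), and let $S_c=S$. Let $\mathcal B=\mathbb Q[\delta_T]$ be the polynomial ring on the isomorphism classes of operadic trees, a forest being identified with the monomial of its trees, and let $\Delta\colon\mathcal B\to\mathcal B\otimes\mathcal B$ be the algebra homomorphism with $$\Delta(\delta_T)=\sum_{c\in\mathrm{cut}(T)}\delta_{P_c}\otimes\delta_{S_c}.$$ \textbf{Theorem.} The map $\Delta$ extends, by substituting $\Delta(\delta_T)$ for each variable $\delta_T$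 (every monomial occurs in only finitely many of the $\Delta(\delta_T)$), to a map from the power series ring $\mathbb Q[[\delta_T]]$ to the completion $\mathbb Q[[\delta_T\otimes 1,\,1\otimes\delta_T]]$ of $\mathcal B\otimes\mathcal B$. Let $$G=\sum_T\frac{\delta_T}{|\mathrm{Aut}(T)|}\in\mathbb Q[[\delta_T]]$$ be the Green function, the sum being over all isomorphism classes of operadic trees, and write $G=\sum_{n\in\mathbb N}g_n$, where $g_n$ is the summand corresponding to trees with $n$ leaves. Then $$\Delta(G)=\sum_{n\in\mathbb N}G^n\otimes g_n .$$ (The infinite sums are sums of formal power series: each monomial occurs in only finitely many terms.) -/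

import Mathlib

open scoped TensorProduct

/-- For a diagram of sets `A ←s─ M ─p→ N ─t→ A` with `s` injective, the walk towards the root:
`s m ↦ t (p m)`, and an edge outside the image of `s` stays where it is. -/
noncomputable def treeWalk {A M N : Type} (s : M → A) (p : M → N) (t : N → A) (x : A) : A :=
  open Classical in if h : ∃ m, s m = x then t (p h.choose) else x

theorem treeWalk_s {A M N : Type} {s : M → A} (p : M → N) (t : N → A)
    (hs : Function.Injective s) (m : M) : treeWalk s p t (s m) = t (p m) := by
  have h : ∃ m', s m' = s m := ⟨m, rfl⟩
  unfold treeWalk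
  rw [dif_pos h, hs h.choose_spec]

theorem treeWalk_of_notMem {A M N : Type} {s : M → A} (p : M → N) (t : N → A) {x : A}
    (hx : ¬ ∃ m, s m = x) : treeWalk s p t x = x := by
  unfold treeWalk
  rw [dif_neg hx]

/-- A (naked) operadic tree: a diagram of finite sets `Edge ←s─ Mark ─p→ Node ─t→ Edge`.
`t b` is the output edge of the node `b`; an element `m : Mark` is a node `p m` with a
marked input edge `s m`. The map `s` is injective and its image misses exactly
one edge, the root; walking towards the root from any edge reaches it in finitely many steps.
Nodes without input edges are allowed. -/
structure OpTree where
  Edge : Type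
  Mark : Type
  Node : Type
  finite_edge : Finite Edge
  finite_mark : Finite Mark
  finite_node : Finite Node
  s : Mark → Edge
  p : Mark → Node
  t : Node → Edge
  t_inj : Function.Injective t
  s_inj : Function.Injective s
  root : Edge
  mem_range_s : ∀ x, (∃ m, s m = x) ↔ x ≠ root
  reach : ∀ x, ∃ k : ℕ, (treeWalk s p t)^[k] x = root

attribute [instance] OpTree.finite_edge OpTree.finite_mark OpTree.finite_node

namespace OpTree

/-- The walk-to-the-root function of a tree. -/
noncomputable def walk (T : OpTree) : T.Edge → T.Edge := treeWalk T.s T.p T.t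

theorem walk_s (T : OpTree) (m : T.Mark) : T.walk (T.s m) = T.t (T.p m) :=
  treeWalk_s T.p T.t T.s_inj m

theorem walk_root (T : OpTree) : T.walk T.root = T.root :=
  treeWalk_of_notMem T.p T.t (fun h => (T.mem_range_s T.root).1 h rfl)

theorem walk_iterate_root (T : OpTree) (k : ℕ) : T.walk^[k] T.root = T.root :=
  Function.iterate_fixed T.walk_root k

/-- A leaf of a tree: an edge which is not the output edge of a node. -/
def Leaf (T : OpTree) : Type := {x : T.Edge // x ∉ Set.range T.t}

instance (T : OpTree) : Finite T.Leaf := Subtype.finite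

noncomputable instance (T : OpTree) : Fintype T.Leaf := Fintype.ofFinite _

/-- The number of leaves. -/
noncomputable def numLeaves (T : OpTree) : ℕ := Nat.card T.Leaf

/-- An isomorphism of trees: an isomorphism of diagrams. -/
@[ext] structure Iso (S T : OpTree) where
  edge : S.Edge ≃ T.Edge
  mark : S.Mark ≃ T.Mark
  node : S.Node ≃ T.Node
  comm_s : ∀ m, edge (S.s m) = T.s (mark m)
  comm_p : ∀ m, node (S.p m) = T.p (mark m)
  comm_t : ∀ b, edge (S.t b) = T.t (node b)

namespace Iso

def refl (T : OpTree) : Iso T T where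
  edge := Equiv.refl _
  mark := Equiv.refl _
  node := Equiv.refl _
  comm_s _ := rfl
  comm_p _ := rfl
  comm_t _ := rfl

def symm {S T : OpTree} (f : Iso S T) : Iso T S where
  edge := f.edge.symm
  mark := f.mark.symm
  node := f.node.symm
  comm_s m := by rw [Equiv.symm_apply_eq, f.comm_s, Equiv.apply_symm_apply]
  comm_p m := by rw [Equiv.symm_apply_eq, f.comm_p, Equiv.apply_symm_apply]
  comm_t b := by rw [Equiv.symm_apply_eq, f.comm_t, Equiv.apply_symm_apply]

def trans {S T U : OpTree} (f : Iso S T) (g : Iso T U) : Iso S U where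
  edge := f.edge.trans g.edge
  mark := f.mark.trans g.mark
  node := f.node.trans g.node
  comm_s m := by simp [f.comm_s, g.comm_s]
  comm_p m := by simp [f.comm_p, g.comm_p]
  comm_t b := by simp [f.comm_t, g.comm_t]

theorem edge_root {S T : OpTree} (f : Iso S T) : f.edge S.root = T.root := by
  by_contra h
  obtain ⟨m, hm⟩ := (T.mem_range_s _).2 h
  refine (S.mem_range_s S.root).1 ⟨f.mark.symm m, f.edge.injective ?_⟩ rfl
  rw [f.comm_s, Equiv.apply_symm_apply, hm]

theorem edge_walk {S T : OpTree} (f : Iso S T) (x : S.Edge) :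
    f.edge (S.walk x) = T.walk (f.edge x) := by
  by_cases hx : x = S.root
  · rw [hx, walk_root, edge_root, walk_root]
  · obtain ⟨m, rfl⟩ := (S.mem_range_s x).2 hx
    rw [walk_s, f.comm_s, walk_s, f.comm_t, f.comm_p]

theorem edge_walk_iterate {S T : OpTree} (f : Iso S T) (k : ℕ) (x : S.Edge) :
    f.edge (S.walk^[k] x) = T.walk^[k] (f.edge x) := by
  induction k generalizing x with
  | zero => rfl
  | succ k ih => rw [Function.iterate_succ_apply, ih, edge_walk, Function.iterate_succ_apply]

theorem mem_range_t {S T : OpTree} (f : Iso S T) (x : S.Edge) :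
    x ∈ Set.range S.t ↔ f.edge x ∈ Set.range T.t := by
  constructor
  · rintro ⟨b, rfl⟩
    exact ⟨f.node b, (f.comm_t b).symm⟩
  · rintro ⟨b, hb⟩
    refine ⟨f.node.symm b, f.edge.injective ?_⟩
    rw [f.comm_t, Equiv.apply_symm_apply, hb]

/-- The bijection on leaves induced by an isomorphism. -/
def leaf {S T : OpTree} (f : Iso S T) : S.Leaf ≃ T.Leaf :=
  f.edge.subtypeEquiv fun x => not_congr (f.mem_range_t x)

/-- Conjugation by an isomorphism. -/
def conj {S T : OpTree} (f : Iso S T) : Iso S S ≃ Iso T T where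
  toFun g := f.symm.trans (g.trans f)
  invFun g := f.trans (g.trans f.symm)
  left_inv g := by ext <;> simp [trans, symm]
  right_inv g := by ext <;> simp [trans, symm]

end Iso

/-- Isomorphism of trees as an equivalence relation. -/
instance isoSetoid : Setoid OpTree where
  r S T := Nonempty (Iso S T)
  iseqv := ⟨fun T => ⟨Iso.refl T⟩, fun ⟨f⟩ => ⟨f.symm⟩, fun ⟨f⟩ ⟨g⟩ => ⟨f.trans g⟩⟩

/-- A general criterion for the walk in a subdiagram to reach its root. -/
theorem reach_of_sub (T : OpTree) {A M N : Type} (s : M → A) (p : M → N) (t : N → A)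
    (hs : Function.Injective s) (r : A) (hr : ∀ x, x ≠ r → ∃ m, s m = x)
    (α : A → T.Edge) (hα : Function.Injective α) (μ : M → T.Mark)
    (h₁ : ∀ m, α (s m) = T.s (μ m)) (h₂ : ∀ m, α (t (p m)) = T.t (T.p (μ m)))
    (k : ℕ) (x : A) (hx : T.walk^[k] (α x) = α r) : ∃ j : ℕ, (treeWalk s p t)^[j] x = r := by
  induction k generalizing x with
  | zero => exact ⟨0, hα hx⟩
  | succ k ih =>
    by_cases hxr : x = r
    · exact ⟨0, hxr⟩
    · obtain ⟨m, rfl⟩ := hr x hxr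
      rw [Function.iterate_succ_apply, h₁, walk_s, ← h₂] at hx
      obtain ⟨j, hj⟩ := ih _ hx
      exact ⟨j + 1, by rw [Function.iterate_succ_apply, treeWalk_s p t hs, hj]⟩

/-- `x` lies (weakly) above the edge `e`: walking towards the root from `x` one meets `e`. -/
def Above (T : OpTree) (e x : T.Edge) : Prop := ∃ k : ℕ, T.walk^[k] x = e

theorem Above.s_of_t {T : OpTree} {e : T.Edge} {m : T.Mark} (h : T.Above e (T.t (T.p m))) :
    T.Above e (T.s m) := by
  obtain ⟨k, hk⟩ := h
  exact ⟨k + 1, by rw [Function.iterate_succ_apply, walk_s, hk]⟩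

theorem not_above_walk_self {T : OpTree} {m : T.Mark} :
    ¬ T.Above (T.s m) (T.t (T.p m)) := by
  rintro ⟨k, hk⟩
  have hper : T.walk^[k + 1] (T.s m) = T.s m := by
    rw [Function.iterate_succ_apply, walk_s, hk]
  obtain ⟨j, hj⟩ : ∃ j : ℕ, T.walk^[j] (T.s m) = T.root := T.reach (T.s m)
  have h1 : T.walk^[(k + 1) * j] (T.s m) = T.s m := by
    rw [Function.iterate_mul]
    exact Function.iterate_fixed hper j
  have h2 : (k + 1) * j = k * j + j := by ring
  rw [h2, Function.iterate_add_apply, hj, walk_iterate_root] at h1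
  exact (T.mem_range_s (T.s m)).1 ⟨m, rfl⟩ h1.symm

/-- An edge strictly above `e` is an input edge of a node lying above `e`. -/
theorem Above.exists_mark {T : OpTree} {e x : T.Edge} (h : T.Above e x) (hne : x ≠ e) :
    ∃ m, T.s m = x ∧ T.Above e (T.t (T.p m)) := by
  obtain ⟨k, hk⟩ := h
  cases k with
  | zero => exact absurd hk hne
  | succ k =>
    by_cases hxr : x = T.root
    · subst hxr
      exact absurd ((T.walk_iterate_root _).symm.trans hk) hne
    · obtain ⟨m, rfl⟩ := (T.mem_range_s x).2 hxr
      rw [Function.iterate_succ_apply, walk_s] at hk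
      exact ⟨m, rfl, k, hk⟩

/-- The ideal subtree of `T` generated by the edge `e`: `e` becomes the root, and all edges and
nodes above it are kept. -/
def ideal (T : OpTree) (e : T.Edge) : OpTree where
  Edge := {x : T.Edge // T.Above e x}
  Mark := {m : T.Mark // T.Above e (T.t (T.p m))}
  Node := {b : T.Node // T.Above e (T.t b)}
  finite_edge := Subtype.finite
  finite_mark := Subtype.finite
  finite_node := Subtype.finite
  s m := ⟨T.s m.1, m.2.s_of_t⟩
  p m := ⟨T.p m.1, m.2⟩
  t b := ⟨T.t b.1, b.2⟩
  t_inj b b' h := Subtype.ext (T.t_inj (congrArg Subtype.val h))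
  s_inj m m' h := Subtype.ext (T.s_inj (congrArg Subtype.val h))
  root := ⟨e, 0, rfl⟩
  mem_range_s := by
    rintro ⟨x, hx⟩
    constructor
    · rintro ⟨⟨m, hm⟩, h⟩ h'
      have h1 : T.s m = x := congrArg Subtype.val h
      have h2 : x = e := congrArg Subtype.val h'
      rw [← h2, ← h1] at hm
      exact not_above_walk_self hm
    · intro hne
      obtain ⟨m, rfl, hm⟩ := hx.exists_mark fun h => hne (Subtype.ext h)
      exact ⟨⟨m, hm⟩, rfl⟩
  reach := by
    rintro ⟨x, k, hk⟩
    refine reach_of_sub T _ _ _ ?_ _ ?_ Subtype.val Subtype.val_injective Subtype.val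
      (fun _ => rfl) (fun _ => rfl) k _ hk
    · exact fun m m' h => Subtype.ext (T.s_inj (congrArg Subtype.val h))
    · rintro ⟨x, hx⟩ hne
      obtain ⟨m, rfl, hm⟩ := hx.exists_mark fun h => hne (Subtype.ext h)
      exact ⟨⟨m, hm⟩, rfl⟩

/-- A cut of `T`: a subtree containing the root. It consists of a set of nodes and a set of edges,
closed under output edges and containing the root edge; the third condition says that
the subtree is arity preserving (with a node it contains all input edges of that node) and that
each of its edges other than the root is an input edge of one of its nodes. -/
@[ext] structure Cut (T : OpTree) where
  edges : Set T.Edge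
  nodes : Set T.Node
  root_mem : T.root ∈ edges
  t_mem : ∀ b ∈ nodes, T.t b ∈ edges
  s_mem_iff : ∀ m, T.s m ∈ edges ↔ T.p m ∈ nodes

namespace Cut

instance (T : OpTree) : Finite T.Cut :=
  Finite.of_injective (fun c : T.Cut => (c.edges, c.nodes)) fun _ _ h =>
    Cut.ext (congrArg Prod.fst h) (congrArg Prod.snd h)

noncomputable instance (T : OpTree) : Fintype T.Cut := Fintype.ofFinite _

/-- The subtree of `T` given by a cut. -/
def toTree {T : OpTree} (c : T.Cut) : OpTree where
  Edge := {x : T.Edge // x ∈ c.edges}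
  Mark := {m : T.Mark // T.p m ∈ c.nodes}
  Node := {b : T.Node // b ∈ c.nodes}
  finite_edge := Subtype.finite
  finite_mark := Subtype.finite
  finite_node := Subtype.finite
  s m := ⟨T.s m.1, (c.s_mem_iff m.1).2 m.2⟩
  p m := ⟨T.p m.1, m.2⟩
  t b := ⟨T.t b.1, c.t_mem b.1 b.2⟩
  t_inj b b' h := Subtype.ext (T.t_inj (congrArg Subtype.val h))
  s_inj m m' h := Subtype.ext (T.s_inj (congrArg Subtype.val h))
  root := ⟨T.root, c.root_mem⟩
  mem_range_s := by
    rintro ⟨x, hx⟩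
    constructor
    · rintro ⟨⟨m, hm⟩, h⟩ h'
      exact (T.mem_range_s x).1 ⟨m, congrArg Subtype.val h⟩ (congrArg Subtype.val h')
    · intro hne
      obtain ⟨m, rfl⟩ := (T.mem_range_s x).2 fun h => hne (Subtype.ext h)
      exact ⟨⟨m, (c.s_mem_iff m).1 hx⟩, rfl⟩
  reach := by
    rintro ⟨x, hx⟩
    obtain ⟨k, hk⟩ := T.reach x
    refine reach_of_sub T _ _ _ ?_ _ ?_ Subtype.val Subtype.val_injective Subtype.val
      (fun _ => rfl) (fun _ => rfl) k _ hk
    · exact fun m m' h => Subtype.ext (T.s_inj (congrArg Subtype.val h))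
    · rintro ⟨x, hx⟩ hne
      obtain ⟨m, rfl⟩ := (T.mem_range_s x).2 fun h => hne (Subtype.ext h)
      exact ⟨⟨m, (c.s_mem_iff m).1 hx⟩, rfl⟩

/-- The edge of `T` underlying a leaf of the subtree given by a cut. -/
def leafEdge {T : OpTree} (c : T.Cut) (l : c.toTree.Leaf) : T.Edge := l.1.1

end Cut

namespace Iso

theorem above_iff {S T : OpTree} (f : Iso S T) (e x : S.Edge) :
    S.Above e x ↔ T.Above (f.edge e) (f.edge x) :=
  exists_congr fun k => by rw [← edge_walk_iterate, f.edge.apply_eq_iff_eq]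

/-- The isomorphism between ideal subtrees induced by an isomorphism. -/
def ideal {S T : OpTree} (f : Iso S T) (e : S.Edge) :
    Iso (S.ideal e) (T.ideal (f.edge e)) where
  edge := f.edge.subtypeEquiv fun x => f.above_iff e x
  mark := f.mark.subtypeEquiv fun m => by rw [f.above_iff, f.comm_t, f.comm_p]
  node := f.node.subtypeEquiv fun b => by rw [f.above_iff, f.comm_t]
  comm_s m := Subtype.ext (f.comm_s m.1)
  comm_p m := Subtype.ext (f.comm_p m.1)
  comm_t b := Subtype.ext (f.comm_t b.1)

/-- Transport of cuts along an isomorphism. -/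
def mapCut {S T : OpTree} (f : Iso S T) (c : S.Cut) : T.Cut where
  edges := {x | f.symm.edge x ∈ c.edges}
  nodes := {b | f.symm.node b ∈ c.nodes}
  root_mem := by
    have := c.root_mem
    rwa [← f.symm.edge_root] at this
  t_mem b hb := by
    have := c.t_mem _ hb
    rwa [← f.symm.comm_t] at this
  s_mem_iff m := by
    change f.symm.edge (T.s m) ∈ c.edges ↔ f.symm.node (T.p m) ∈ c.nodes
    rw [f.symm.comm_s, f.symm.comm_p]
    exact c.s_mem_iff _

def cut {S T : OpTree} (f : Iso S T) : S.Cut ≃ T.Cut where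
  toFun := f.mapCut
  invFun := f.symm.mapCut
  left_inv c := by ext <;> simp [mapCut, symm]
  right_inv c := by ext <;> simp [mapCut, symm]

/-- The isomorphism between the subtrees given by corresponding cuts. -/
def cutTree {S T : OpTree} (f : Iso S T) (c : S.Cut) : Iso c.toTree (f.cut c).toTree where
  edge := f.edge.subtypeEquiv fun x => by simp [cut, mapCut, symm]
  mark := f.mark.subtypeEquiv fun m => by
    simp [cut, mapCut, symm, ← f.comm_p]
  node := f.node.subtypeEquiv fun b => by simp [cut, mapCut, symm]
  comm_s m := Subtype.ext (f.comm_s m.1)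
  comm_p m := Subtype.ext (f.comm_p m.1)
  comm_t b := Subtype.ext (f.comm_t b.1)

end Iso

end OpTree

/-- The set of isomorphism classes of operadic trees. -/
abbrev TreeClass : Type 1 := Quotient OpTree.isoSetoid

/-- The polynomial algebra over `ℚ` on the set of isomorphism classes of trees. -/
abbrev TreeAlg : Type 1 := MvPolynomial TreeClass ℚ

namespace OpTree

/-- The isomorphism class of a tree. -/
def cls (T : OpTree) : TreeClass := Quotient.mk _ T

theorem cls_eq {S T : OpTree} (f : Iso S T) : S.cls = T.cls := Quotient.sound ⟨f⟩

/-- The forest of all ideal subtrees generated by the leaves of a cut, as a monomial. -/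
noncomputable def Cut.forest {T : OpTree} (c : T.Cut) : TreeAlg :=
  ∏ l : c.toTree.Leaf, MvPolynomial.X (T.ideal (c.leafEdge l)).cls

/-- The comultiplication on a tree: the sum over all cuts `c` of `P_c ⊗ S_c`. -/
noncomputable def comulTree (T : OpTree) : TreeAlg ⊗[ℚ] TreeAlg :=
  ∑ c : T.Cut, c.forest ⊗ₜ[ℚ] MvPolynomial.X c.toTree.cls

theorem comulTree_eq {S T : OpTree} (f : Iso S T) : S.comulTree = T.comulTree := by
  refine Fintype.sum_equiv f.cut _ _ fun c => ?_
  have h : c.forest = (f.cut c).forest :=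
    Fintype.prod_equiv (f.cutTree c).leaf _ _ fun l => by
      rw [cls_eq (f.ideal (c.leafEdge l))]
      rfl
  rw [h, cls_eq (f.cutTree c)]

end OpTree

/-- The order of the automorphism group of a tree. -/
noncomputable def TreeClass.autCard : TreeClass → ℕ :=
  Quotient.lift (fun T : OpTree => Nat.card (OpTree.Iso T T))
    fun _ _ ⟨f⟩ => Nat.card_congr f.conj

/-- The number of leaves of a tree. -/
noncomputable def TreeClass.numLeaves : TreeClass → ℕ :=
  Quotient.lift OpTree.numLeaves fun _ _ ⟨f⟩ => Nat.card_congr f.leaf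

/-- The comultiplication `Δ` on generators. -/
noncomputable def TreeClass.comul : TreeClass → TreeAlg ⊗[ℚ] TreeAlg :=
  Quotient.lift OpTree.comulTree fun _ _ ⟨f⟩ => OpTree.comulTree_eq f

/-- The comultiplication `Δ`, as an algebra homomorphism. -/
noncomputable def treeComul : TreeAlg →ₐ[ℚ] TreeAlg ⊗[ℚ] TreeAlg :=
  MvPolynomial.aeval TreeClass.comul

/-- The completion of `TreeAlg`: power series in the isomorphism classes of trees. -/
abbrev TreeSeries : Type 1 := MvPowerSeries TreeClass ℚ

/-- The completion of `TreeAlg ⊗ TreeAlg`: power series in two families of variables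
`δ_T ⊗ 1` (left summand) and `1 ⊗ δ_T` (right summand). -/
abbrev TreeSeries₂ : Type 1 := MvPowerSeries (TreeClass ⊕ TreeClass) ℚ

/-- The canonical map from `TreeAlg ⊗ TreeAlg` to its completion. -/
noncomputable def toTreeSeries₂ : TreeAlg ⊗[ℚ] TreeAlg →ₐ[ℚ] TreeSeries₂ :=
  (MvPolynomial.coeToMvPowerSeries.algHom ℚ).comp
    (Algebra.TensorProduct.productMap
      (MvPolynomial.rename Sum.inl : TreeAlg →ₐ[ℚ] MvPolynomial (TreeClass ⊕ TreeClass) ℚ)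
      (MvPolynomial.rename Sum.inr : TreeAlg →ₐ[ℚ] MvPolynomial (TreeClass ⊕ TreeClass) ℚ))

/-- The tensor product `f ⊗ g` of two power series, in the completed tensor product. -/
noncomputable def TreeSeries.tensor (f g : TreeSeries) : TreeSeries₂ := fun d =>
  MvPowerSeries.coeff (Finsupp.sumFinsuppEquivProdFinsupp d).1 f *
    MvPowerSeries.coeff (Finsupp.sumFinsuppEquivProdFinsupp d).2 g

/-- The extension of `Δ` to power series: substitute `Δ(δ_T)` for each variable `δ_T`. -/
noncomputable def TreeSeries.comul (f : TreeSeries) : TreeSeries₂ :=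
  MvPowerSeries.subst (fun τ : TreeClass => toTreeSeries₂ (treeComul (MvPolynomial.X τ))) f

/-- `F = ∑ i, f i` as formal power series: every monomial occurs in only finitely many of
the `f i`, and its coefficient in `F` is the (finite) sum of its coefficients in the `f i`. -/
def IsFormalSum {ι σ : Type*} (f : ι → MvPowerSeries σ ℚ) (F : MvPowerSeries σ ℚ) : Prop :=
  ∀ d : σ →₀ ℕ, (Function.support fun i => MvPowerSeries.coeff d (f i)).Finite ∧
    MvPowerSeries.coeff d F = ∑ᶠ i, MvPowerSeries.coeff d (f i)

/-- The power series `∑ τ, a τ • δ_τ` with the given coefficients on the variables. -/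
noncomputable def TreeSeries.linear (a : TreeClass → ℚ) : TreeSeries := fun d =>
  open Classical in ∑ τ ∈ d.support, if d = Finsupp.single τ 1 then a τ else 0

/-- The Green function `G = ∑ T, δ_T / |Aut T|`. -/
noncomputable def greenFunction : TreeSeries :=
  TreeSeries.linear fun τ => 1 / (τ.autCard : ℚ)

/-- The summand `g_n` of the Green function corresponding to trees with `n` leaves. -/
noncomputable def greenSummand (n : ℕ) : TreeSeries :=
  TreeSeries.linear fun τ => if τ.numLeaves = n then 1 / (τ.autCard : ℚ) else 0

/-! Fix a tree `S` and a forest monomial `d`, and compare coefficients of `d ⊗ S`. An isomorphism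
onto `T` from the grafting of trees `f l` on the leaves of `S` amounts to a cut `c` of `T`, an
isomorphism `φ : S ≅ S_c` and, for each leaf `l`, an isomorphism from `f l` to the ideal subtree of
`T` at `φ l` (`card_iso_graft`).

Weight these isomorphisms by `∏ 1/|Aut (f l)|` and sum over all labellings `f` of the leaves with
total forest `d`. For given `(c, φ)` only the labelling by the ideal subtrees can contribute; it
contributes 1, and it has forest `d` iff `P_c` is `d`. So the sum is `|Aut S|` times the number of
cuts with `P_c = d` and `S_c ≅ S` (`sum_inv_mul_card_iso_graft`).

Each grafting has `|Aut T|` or no isomorphisms to `T`. Dividing by `|Aut S| |Aut T|` turns the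
coefficient in `Δ(δ_T)/|Aut T|` into a weighted count of the labellings whose grafting is `T`
(`inv_mul_coeff_comul`). There are finitely many labellings, so substitution makes sense
(`hasSubst_comul`). Summing over `T` drops the condition on the grafting and leaves `1/|Aut S|`
times the coefficient of `d` in `G^n`, with `n` the number of leaves of `S` (`coeff_linear_pow`,
`coeff_comul_greenFunction`). -/

namespace OpTree

/-! ### Isomorphisms are controlled by their edge maps -/

namespace Iso

/-- Since `s` and `t` are injective, marks and nodes can be read off from edges. -/
theorem ext_edge {S T : OpTree} {f g : Iso S T} (h : ∀ x, f.edge x = g.edge x) : f = g := by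
  ext x
  · exact h x
  · exact T.s_inj (by rw [← f.comm_s, ← g.comm_s, h])
  · exact T.t_inj (by rw [← f.comm_t, ← g.comm_t, h])

instance (S T : OpTree) : Finite (Iso S T) :=
  Finite.of_injective (fun f : Iso S T => f.edge) fun _ _ h =>
    ext_edge fun x => congrArg (fun e : S.Edge ≃ T.Edge => e x) h

noncomputable instance (S T : OpTree) : Fintype (Iso S T) := Fintype.ofFinite _

/-- A morphism of diagrams that preserves the root, is bijective on edges and surjective on nodes
is an isomorphism. -/
noncomputable def ofBijective {S T : OpTree} (e : S.Edge → T.Edge) (μ : S.Mark → T.Mark)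
    (ν : S.Node → T.Node) (hs : ∀ m, e (S.s m) = T.s (μ m)) (hp : ∀ m, ν (S.p m) = T.p (μ m))
    (ht : ∀ b, e (S.t b) = T.t (ν b)) (hroot : e S.root = T.root) (he : Function.Bijective e)
    (hν : Function.Surjective ν) : Iso S T where
  edge := Equiv.ofBijective e he
  mark := Equiv.ofBijective μ <| by
    constructor
    · intro m m' h
      exact S.s_inj (he.1 (by rw [hs, hs, h]))
    · intro m'
      obtain ⟨x, hx⟩ := he.2 (T.s m')
      have hne : x ≠ S.root := by
        rintro rfl
        exact (T.mem_range_s _).1 ⟨m', hx.symm⟩ hroot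
      obtain ⟨m, rfl⟩ := (S.mem_range_s x).2 hne
      exact ⟨m, T.s_inj (by rw [← hs, hx])⟩
  node := Equiv.ofBijective ν
    ⟨fun b b' h => S.t_inj (he.1 (by rw [ht, ht, h])), hν⟩
  comm_s := hs
  comm_p := hp
  comm_t := ht

end Iso

/-- Induction from the root upwards. -/
theorem edge_induction (T : OpTree) {P : T.Edge → Prop} (root : P T.root)
    (step : ∀ m, P (T.t (T.p m)) → P (T.s m)) (x : T.Edge) : P x := by
  obtain ⟨k, hk⟩ := T.reach x
  change T.walk^[k] x = T.root at hk
  induction k generalizing x with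
  | zero => exact (show x = T.root from hk) ▸ root
  | succ k ih =>
    by_cases hx : x = T.root
    · exact hx ▸ root
    · obtain ⟨m, rfl⟩ := (T.mem_range_s x).2 hx
      rw [Function.iterate_succ_apply, walk_s] at hk
      exact step m (ih _ hk)

/-- Both edges lie on the one path from `x` to the root; the one met first is above the other. -/
theorem Above.total {T : OpTree} {e e' x : T.Edge} (h : T.Above e x) (h' : T.Above e' x) :
    T.Above e e' ∨ T.Above e' e := by
  obtain ⟨k, rfl⟩ := h
  obtain ⟨k', rfl⟩ := h'
  rcases le_total k k' with hk | hk
  · refine Or.inr ⟨k' - k, ?_⟩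
    rw [← Function.iterate_add_apply, Nat.sub_add_cancel hk]
  · refine Or.inl ⟨k - k', ?_⟩
    rw [← Function.iterate_add_apply, Nat.sub_add_cancel hk]

/-! ### Leaves of a cut -/

namespace Cut

theorem leafEdge_mem {T : OpTree} (c : T.Cut) (l : c.toTree.Leaf) : c.leafEdge l ∈ c.edges :=
  l.1.2

theorem t_ne_leafEdge {T : OpTree} (c : T.Cut) (l : c.toTree.Leaf) {b : T.Node}
    (hb : b ∈ c.nodes) : T.t b ≠ c.leafEdge l :=
  fun h => l.2 ⟨⟨b, hb⟩, Subtype.ext h⟩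

theorem leafEdge_injective {T : OpTree} (c : T.Cut) : Function.Injective c.leafEdge :=
  fun _ _ h => Subtype.ext (Subtype.ext h)

/-- The only edge of a cut that lies above a given leaf is the leaf itself. -/
theorem eq_leafEdge {T : OpTree} (c : T.Cut) (l : c.toTree.Leaf) {x : T.Edge} (hx : x ∈ c.edges)
    (h : T.Above (c.leafEdge l) x) : x = c.leafEdge l := by
  induction x using T.edge_induction with
  | root =>
    obtain ⟨k, hk⟩ := h
    rwa [walk_iterate_root] at hk
  | step m ih =>
    -- Otherwise the node of the cut with input `x` has its output above the leaf too. By induction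
    -- that output is the leaf, but a leaf is no output of a node of the cut.
    by_contra hne
    obtain ⟨m', hm', ha⟩ := h.exists_mark hne
    obtain rfl := T.s_inj hm'
    have hp := (c.s_mem_iff m').1 hx
    exact c.t_ne_leafEdge l hp (ih (c.t_mem _ hp) ha)

end Cut

/-! ### Grafting trees onto the leaves of a tree -/

section Graft

variable (S : OpTree) (f : S.Leaf → OpTree)

/-- The edges of the grafting of a family of trees onto the leaves of a tree: an inner edge of the
lower tree is given by the node below which it lies. -/
abbrev GraftEdge : Type := S.Node ⊕ Σ l : S.Leaf, (f l).Edge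

variable {S}

/-- The embedding of the edges of the lower tree. -/
noncomputable def graftLower (x : S.Edge) : S.GraftEdge f :=
  open Classical in
  -- A leaf has no edge of its own: it is the root of the tree grafted there, so no quotient is
  -- needed for the gluing.
  if h : ∃ b, S.t b = x then Sum.inl h.choose else Sum.inr ⟨⟨x, h⟩, (f _).root⟩

@[simp] theorem graftLower_t (b : S.Node) : graftLower f (S.t b) = Sum.inl b := by
  have h : ∃ b', S.t b' = S.t b := ⟨b, rfl⟩
  unfold graftLower
  rw [dif_pos h, S.t_inj h.choose_spec]

theorem graftLower_leaf (l : S.Leaf) : graftLower f l.1 = Sum.inr ⟨l, (f l).root⟩ := by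
  exact dif_neg l.2

theorem edge_cases (x : S.Edge) : (∃ b, x = S.t b) ∨ ∃ l : S.Leaf, x = l.1 := by
  by_cases h : x ∈ Set.range S.t
  · obtain ⟨b, rfl⟩ := h
    exact Or.inl ⟨b, rfl⟩
  · exact Or.inr ⟨⟨x, h⟩, rfl⟩

theorem graftLower_injective : Function.Injective (graftLower f) := by
  intro x y h
  rcases edge_cases x with ⟨b, rfl⟩ | ⟨l, rfl⟩ <;> rcases edge_cases y with ⟨b', rfl⟩ | ⟨l', rfl⟩ <;>
    simp only [graftLower_t, graftLower_leaf, Sum.inl.injEq, Sum.inr.injEq, reduceCtorEq] at h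
  · rw [h]
  · cases h
    rfl

/-- The lower tree meets an upper one only in the glued root. As that root is no input edge of the
upper tree, this keeps lower and upper marks apart. -/
theorem graftLower_eq_inr {x : S.Edge} {l : S.Leaf} {y : (f l).Edge}
    (h : graftLower f x = Sum.inr ⟨l, y⟩) : x = l.1 ∧ y = (f l).root := by
  rcases edge_cases x with ⟨b, rfl⟩ | ⟨l', rfl⟩
  · simp at h
  · rw [graftLower_leaf, Sum.inr.injEq] at h
    cases h
    exact ⟨rfl, rfl⟩

/-- The input edge of a mark of a grafting. -/
noncomputable def graftS : (S.Mark ⊕ Σ l : S.Leaf, (f l).Mark) → S.GraftEdge f :=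
  Sum.elim (fun m => graftLower f (S.s m)) fun m => Sum.inr ⟨m.1, (f m.1).s m.2⟩

theorem graftS_injective : Function.Injective (graftS f) := by
  rintro (m | ⟨l, m⟩) (m' | ⟨l', m'⟩) h
  · exact congrArg Sum.inl (S.s_inj (graftLower_injective f h))
  · exact absurd (graftLower_eq_inr f h).2 (((f l').mem_range_s _).1 ⟨m', rfl⟩)
  · exact absurd (graftLower_eq_inr f h.symm).2 (((f l).mem_range_s _).1 ⟨m, rfl⟩)
  · simp only [graftS, Sum.elim_inr, Sum.inr.injEq, Sigma.mk.injEq] at h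
    obtain ⟨rfl, h⟩ := h
    rw [(f l).s_inj (eq_of_heq h)]

/-- The node of a mark of a grafting. -/
def graftP : (S.Mark ⊕ Σ l : S.Leaf, (f l).Mark) → S.Node ⊕ Σ l : S.Leaf, (f l).Node :=
  Sum.map S.p fun m => ⟨m.1, (f m.1).p m.2⟩

/-- The output edge of a node of a grafting. -/
def graftT : (S.Node ⊕ Σ l : S.Leaf, (f l).Node) → S.GraftEdge f :=
  Sum.map id fun b => ⟨b.1, (f b.1).t b.2⟩

variable (S) in
/-- The grafting of a family of trees onto the leaves of a tree. -/
noncomputable def graft : OpTree where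
  Edge := S.GraftEdge f
  Mark := S.Mark ⊕ Σ l : S.Leaf, (f l).Mark
  Node := S.Node ⊕ Σ l : S.Leaf, (f l).Node
  finite_edge := inferInstance
  finite_mark := inferInstance
  finite_node := inferInstance
  s := graftS f
  p := graftP f
  t := graftT f
  t_inj := by
    rintro (b | ⟨l, b⟩) (b' | ⟨l', b'⟩) h <;>
      simp only [graftT, Sum.map_inl, Sum.map_inr, id, Sum.inl.injEq, Sum.inr.injEq,
        Sigma.mk.injEq, reduceCtorEq] at h
    · rw [h]
    · obtain ⟨rfl, h⟩ := h
      rw [(f l).t_inj (eq_of_heq h)]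
  s_inj := graftS_injective f
  root := graftLower f S.root
  mem_range_s := by
    intro x
    constructor
    · rintro ⟨m | ⟨l, m⟩, rfl⟩ h
      · exact (S.mem_range_s _).1 ⟨m, rfl⟩ (graftLower_injective f h)
      · exact ((f l).mem_range_s _).1 ⟨m, rfl⟩ (graftLower_eq_inr f h.symm).2
    -- The edges that no upper mark hits, namely inner lower edges and glued roots, all come from
    -- edges of `S`.
    · have key : ∀ y : S.Edge, graftLower f y ≠ graftLower f S.root →
          ∃ m, graftS f m = graftLower f y := by
        intro y hy
        obtain ⟨m, rfl⟩ := (S.mem_range_s y).2 fun h => hy (h ▸ rfl)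
        exact ⟨Sum.inl m, rfl⟩
      intro hx
      rcases x with b | ⟨l, x⟩
      · rw [← graftLower_t] at hx ⊢
        exact key _ hx
      · by_cases hr : x = (f l).root
        · rw [hr, ← graftLower_leaf] at hx ⊢
          exact key _ hx
        · obtain ⟨m, rfl⟩ := ((f l).mem_range_s x).2 hr
          exact ⟨Sum.inr ⟨l, m⟩, rfl⟩
  reach := by
    have step : ∀ m, (∃ k : ℕ, (treeWalk (graftS f) (graftP f) (graftT f))^[k]
          (graftT f (graftP f m)) = graftLower f S.root) →
        ∃ k : ℕ, (treeWalk (graftS f) (graftP f) (graftT f))^[k] (graftS f m) =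
          graftLower f S.root := by
      rintro m ⟨k, hk⟩
      exact ⟨k + 1, by
        rw [Function.iterate_succ_apply, treeWalk_s _ _ (graftS_injective f), hk]⟩
    have low : ∀ x : S.Edge, ∃ k : ℕ, (treeWalk (graftS f) (graftP f) (graftT f))^[k]
        (graftLower f x) = graftLower f S.root := by
      intro x
      induction x using S.edge_induction with
      | root => exact ⟨0, rfl⟩
      | step m ih =>
        rw [graftLower_t] at ih
        exact step (Sum.inl m) ih
    rintro (b | ⟨l, x⟩)
    · rw [← graftLower_t]
      exact low _
    · induction x using (f l).edge_induction with
      | root =>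
        rw [← graftLower_leaf]
        exact low _
      | step m ih => exact step (Sum.inr ⟨l, m⟩) ih

/-- The upper component in which an edge of a grafting lies, if any. -/
def graftComponent : (S.graft f).Edge → Option S.Leaf :=
  Sum.elim (fun _ => none) fun x => some x.1

/-- The output of a lower node lies in no component, so a node with output in component `l` is a
node of `f l`, and its inputs stay there. -/
theorem graftComponent_eq_of_above {l : S.Leaf} {e x : (S.graft f).Edge}
    (he : graftComponent f e = some l) (h : (S.graft f).Above e x) :
    graftComponent f x = some l := by
  induction x using (S.graft f).edge_induction with
  | root =>
    obtain ⟨k, hk⟩ := h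
    rw [walk_iterate_root] at hk
    rwa [hk]
  | step m ih =>
    by_cases hne : (S.graft f).s m = e
    · rwa [hne]
    · obtain ⟨m', hm', ha⟩ := h.exists_mark hne
      obtain rfl := (S.graft f).s_inj hm'
      have := ih ha
      rcases m' with m | m
      · exact absurd this (by simp [graft, graftP, graftT, graftComponent])
      · exact this

theorem graft_above (l : S.Leaf) (x : (f l).Edge) :
    (S.graft f).Above (graftLower f l.1) (Sum.inr ⟨l, x⟩) := by
  induction x using (f l).edge_induction with
  | root => exact ⟨0, (graftLower_leaf f l).symm⟩
  | step m ih => exact Above.s_of_t (T := S.graft f) (m := Sum.inr ⟨l, m⟩) ih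

theorem graft_above_iff (l : S.Leaf) (x : (S.graft f).Edge) :
    (S.graft f).Above (graftLower f l.1) x ↔ ∃ y, x = Sum.inr ⟨l, y⟩ := by
  constructor
  · intro h
    have := graftComponent_eq_of_above f (l := l) (by rw [graftLower_leaf]; rfl) h
    rcases x with b | ⟨l', y⟩
    · cases this
    · cases this
      exact ⟨y, rfl⟩
  · rintro ⟨y, rfl⟩
    exact graft_above f l y

/-- The lower tree of a grafting, as a cut. -/
noncomputable def graftCut : (S.graft f).Cut where
  edges := Set.range (graftLower f)
  nodes := Set.range Sum.inl
  root_mem := ⟨S.root, rfl⟩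
  t_mem := by
    rintro _ ⟨b, rfl⟩
    exact ⟨S.t b, graftLower_t f b⟩
  s_mem_iff := by
    rintro (m | ⟨l, m⟩)
    · exact iff_of_true ⟨S.s m, rfl⟩ ⟨S.p m, rfl⟩
    · refine iff_of_false ?_ ?_
      · rintro ⟨x, hx⟩
        exact ((f l).mem_range_s _).1 ⟨m, rfl⟩ (graftLower_eq_inr f hx).2
      · rintro ⟨b, hb⟩
        cases hb

/-- The lower tree of a grafting is the given one. -/
noncomputable def graftCutIso : Iso S (graftCut f).toTree :=
  Iso.ofBijective (fun x => ⟨graftLower f x, x, rfl⟩) (fun m => ⟨Sum.inl m, S.p m, rfl⟩)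
    (fun b => ⟨Sum.inl b, b, rfl⟩) (fun _ => rfl) (fun _ => rfl)
    (fun b => Subtype.ext (graftLower_t f b)) rfl
    ⟨fun _ _ h => graftLower_injective f (congrArg Subtype.val h), by
      rintro ⟨_, x, rfl⟩
      exact ⟨x, rfl⟩⟩
    (by
      rintro ⟨_, b, rfl⟩
      exact ⟨b, rfl⟩)

/-- The upper trees of a grafting are the given ones. -/
noncomputable def graftIdealIso (l : S.Leaf) :
    Iso (f l) ((S.graft f).ideal ((graftCut f).leafEdge ((graftCutIso f).leaf l))) :=
  Iso.ofBijective (fun x => ⟨Sum.inr ⟨l, x⟩, graft_above f l x⟩)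
    (fun m => ⟨Sum.inr ⟨l, m⟩, graft_above f l _⟩)
    (fun b => ⟨Sum.inr ⟨l, b⟩, graft_above f l _⟩) (fun _ => rfl) (fun _ => rfl)
    (fun _ => rfl) (Subtype.ext (graftLower_leaf f l).symm)
    ⟨fun x y h => by
      have h' := congrArg Subtype.val h
      cases h'
      rfl, by
      rintro ⟨x, hx⟩
      obtain ⟨y, rfl⟩ := (graft_above_iff f l x).1 hx
      exact ⟨y, rfl⟩⟩
    (by
      rintro ⟨b, hb⟩
      obtain ⟨y, hy⟩ := (graft_above_iff f l _).1 hb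
      rcases b with b | ⟨l', b⟩
      · cases hy
      · cases hy
        exact ⟨b, rfl⟩)

/-! ### Isomorphisms from a grafting correspond to decompositions -/

/-- A decomposition of `T` as a grafting of the trees `f l` onto `S`. -/
abbrev Decomposition (T : OpTree) : Type :=
  Σ c : T.Cut, Σ φ : Iso S c.toTree, ∀ l, Iso (f l) (T.ideal (c.leafEdge (φ.leaf l)))

variable {f} {T : OpTree}

/-- The decomposition given by an isomorphism with the grafting. -/
noncomputable def decompositionOfIso (g : Iso (S.graft f) T) : Decomposition f T :=
  ⟨g.cut (graftCut f), (graftCutIso f).trans (g.cutTree (graftCut f)),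
    fun l => (graftIdealIso f l).trans (g.ideal _)⟩

namespace Decomposition

/-- The map on edges from the grafting given by a decomposition. -/
def edgeMap (d : Decomposition f T) : (S.graft f).Edge → T.Edge :=
  Sum.elim (fun b => (d.2.1.edge (S.t b)).1) fun x => ((d.2.2 x.1).edge x.2).1

/-- The two halves of the map agree along the gluing: the root of `f l` goes to the root of the
ideal subtree, which is the leaf edge itself. -/
theorem edgeMap_graftLower (d : Decomposition f T) (x : S.Edge) :
    d.edgeMap (graftLower f x) = (d.2.1.edge x).1 := by
  rcases edge_cases x with ⟨b, rfl⟩ | ⟨l, rfl⟩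
  · rw [graftLower_t]
    rfl
  · rw [graftLower_leaf]
    exact congrArg Subtype.val (d.2.2 l).edge_root

theorem edgeMap_inl (d : Decomposition f T) (b : S.Node) :
    d.edgeMap (Sum.inl b) = T.t (d.2.1.node b).1 :=
  congrArg Subtype.val (d.2.1.comm_t b)

theorem above_edgeMap (d : Decomposition f T) (l : S.Leaf) (x : (f l).Edge) :
    T.Above (d.1.leafEdge (d.2.1.leaf l)) (d.edgeMap (Sum.inr ⟨l, x⟩)) :=
  ((d.2.2 l).edge x).2

/-- An edge of the cut above a leaf must be that leaf, which is not the output of a node of the cut.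
-/
theorem edgeMap_inl_ne_inr (d : Decomposition f T) (b : S.Node) (l : S.Leaf) (x : (f l).Edge) :
    d.edgeMap (Sum.inl b) ≠ d.edgeMap (Sum.inr ⟨l, x⟩) := by
  intro h
  have ha := d.above_edgeMap l x
  rw [← h, edgeMap_inl] at ha
  exact d.1.t_ne_leafEdge _ (d.2.1.node b).2
    (d.1.eq_leafEdge _ (d.1.t_mem _ (d.2.1.node b).2) ha)

theorem edgeMap_injective (d : Decomposition f T) : Function.Injective d.edgeMap := by
  rintro (b | ⟨l, x⟩) (b' | ⟨l', x'⟩) h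
  · rw [edgeMap_inl, edgeMap_inl] at h
    rw [d.2.1.node.injective (Subtype.ext (T.t_inj h))]
  · exact absurd h (d.edgeMap_inl_ne_inr _ _ _)
  · exact absurd h.symm (d.edgeMap_inl_ne_inr _ _ _)
  · have ha := d.above_edgeMap l x
    have ha' := d.above_edgeMap l' x'
    rw [← h] at ha'
    -- Two leaves of the cut below a common edge are comparable, hence equal.
    have hl : d.1.leafEdge (d.2.1.leaf l) = d.1.leafEdge (d.2.1.leaf l') := by
      rcases ha.total ha' with h' | h'
      · exact (d.1.eq_leafEdge _ (d.1.leafEdge_mem _) h').symm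
      · exact d.1.eq_leafEdge _ (d.1.leafEdge_mem _) h'
    obtain rfl := d.2.1.leaf.injective (d.1.leafEdge_injective hl)
    exact congrArg (fun z => (Sum.inr ⟨l, z⟩ : S.GraftEdge f))
      ((d.2.2 l).edge.injective (Subtype.ext h))

theorem edgeMap_surjective (d : Decomposition f T) : Function.Surjective d.edgeMap := by
  intro y
  induction y using T.edge_induction with
  | root =>
    refine ⟨graftLower f S.root, ?_⟩
    rw [edgeMap_graftLower, d.2.1.edge_root]
    rfl
  | step m ih =>
    obtain ⟨b | ⟨l, x⟩, hz⟩ := ih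
    · rw [edgeMap_inl] at hz
      -- The node below this edge belongs to the cut, and a cut contains all inputs of its nodes.
      have hm : T.s m ∈ d.1.edges := (d.1.s_mem_iff m).2 (T.t_inj hz ▸ (d.2.1.node b).2)
      refine ⟨graftLower f (d.2.1.edge.symm ⟨_, hm⟩), ?_⟩
      exact (d.edgeMap_graftLower _).trans
        (congrArg Subtype.val (d.2.1.edge.apply_symm_apply _))
    · have ha := d.above_edgeMap l x
      rw [hz] at ha
      refine ⟨Sum.inr ⟨l, (d.2.2 l).edge.symm ⟨_, ha.s_of_t⟩⟩, ?_⟩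
      exact congrArg Subtype.val ((d.2.2 l).edge.apply_symm_apply _)

/-- A decomposition gives an isomorphism with the grafting. -/
noncomputable def toIso (d : Decomposition f T) : Iso (S.graft f) T :=
  Iso.ofBijective d.edgeMap
    (Sum.elim (fun m => (d.2.1.mark m).1) fun m => ((d.2.2 m.1).mark m.2).1)
    (Sum.elim (fun b => (d.2.1.node b).1) fun b => ((d.2.2 b.1).node b.2).1)
    (by
      rintro (m | ⟨l, m⟩)
      · exact (d.edgeMap_graftLower _).trans (congrArg Subtype.val (d.2.1.comm_s m))
      · exact congrArg Subtype.val ((d.2.2 l).comm_s m))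
    (by
      rintro (m | ⟨l, m⟩)
      · exact congrArg Subtype.val (d.2.1.comm_p m)
      · exact congrArg Subtype.val ((d.2.2 l).comm_p m))
    (by
      rintro (b | ⟨l, b⟩)
      · exact d.edgeMap_inl b
      · exact congrArg Subtype.val ((d.2.2 l).comm_t b))
    ((d.edgeMap_graftLower _).trans (congrArg Subtype.val d.2.1.edge_root))
    ⟨d.edgeMap_injective, d.edgeMap_surjective⟩
    (by
      intro b'
      obtain ⟨b | ⟨l, x⟩, hz⟩ := d.edgeMap_surjective (T.t b')
      · rw [edgeMap_inl] at hz
        exact ⟨Sum.inl b, T.t_inj hz⟩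
      · have ha := d.above_edgeMap l x
        rw [hz] at ha
        refine ⟨Sum.inr ⟨l, (d.2.2 l).node.symm ⟨b', ha⟩⟩, ?_⟩
        exact congrArg Subtype.val ((d.2.2 l).node.apply_symm_apply _))

theorem toIso_edge (d : Decomposition f T) (x : (S.graft f).Edge) :
    d.toIso.edge x = d.edgeMap x := rfl

theorem toIso_injective : Function.Injective (toIso : Decomposition f T → Iso (S.graft f) T) := by
  intro d d' h
  have hE : ∀ x, d.edgeMap x = d'.edgeMap x := fun x => by rw [← toIso_edge, h, toIso_edge]
  -- Values are compared inside `T`, since the components have different types until the cuts agree.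
  -- The cut itself is recovered as the image of the edges and nodes of `S`.
  have hφ : ∀ x, (d.2.1.edge x).1 = (d'.2.1.edge x).1 := fun x =>
    (d.edgeMap_graftLower x).symm.trans ((hE _).trans (d'.edgeMap_graftLower x))
  have hν : ∀ b, (d.2.1.node b).1 = (d'.2.1.node b).1 := fun b =>
    T.t_inj ((d.edgeMap_inl b).symm.trans ((hE _).trans (d'.edgeMap_inl b)))
  have hψ : ∀ l x, ((d.2.2 l).edge x).1 = ((d'.2.2 l).edge x).1 := fun l x => hE (Sum.inr ⟨l, x⟩)
  obtain ⟨c, φ, ψ⟩ := d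
  obtain ⟨c', φ', ψ'⟩ := d'
  dsimp only at hφ hν hψ
  have hc : c = c' := by
    apply Cut.ext
    · ext x
      constructor
      · intro hx
        obtain ⟨y, hy⟩ := φ.edge.surjective ⟨x, hx⟩
        have hyx : (φ.edge y).1 = x := congrArg Subtype.val hy
        rw [← hyx, hφ y]
        exact (φ'.edge y).2
      · intro hx
        obtain ⟨y, hy⟩ := φ'.edge.surjective ⟨x, hx⟩
        have hyx : (φ'.edge y).1 = x := congrArg Subtype.val hy
        rw [← hyx, ← hφ y]
        exact (φ.edge y).2
    · ext x
      constructor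
      · intro hx
        obtain ⟨y, hy⟩ := φ.node.surjective ⟨x, hx⟩
        have hyx : (φ.node y).1 = x := congrArg Subtype.val hy
        rw [← hyx, hν y]
        exact (φ'.node y).2
      · intro hx
        obtain ⟨y, hy⟩ := φ'.node.surjective ⟨x, hx⟩
        have hyx : (φ'.node y).1 = x := congrArg Subtype.val hy
        rw [← hyx, ← hν y]
        exact (φ.node y).2
  subst hc
  obtain rfl : φ = φ' := Iso.ext_edge fun x => Subtype.ext (hφ x)
  obtain rfl : ψ = ψ' := funext fun l => Iso.ext_edge fun x => Subtype.ext (hψ l x)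
  rfl

theorem toIso_decompositionOfIso (g : Iso (S.graft f) T) : toIso (decompositionOfIso g) = g := by
  refine Iso.ext_edge ?_
  rintro (b | ⟨l, x⟩)
  · exact congrArg g.edge (graftLower_t f b)
  · rfl

end Decomposition

variable (f T) in
/-- Isomorphisms with a grafting are the same as decompositions. -/
theorem card_iso_graft : Nat.card (Iso (S.graft f) T) = Nat.card (Decomposition f T) :=
  (Nat.card_congr (Equiv.ofBijective Decomposition.toIso
    ⟨Decomposition.toIso_injective,
      fun g => ⟨_, Decomposition.toIso_decompositionOfIso g⟩⟩)).symm

end Graft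

end OpTree

/-! ### Counting isomorphisms between isomorphism classes -/

namespace OpTree

theorem card_iso_self_pos (T : OpTree) : 0 < Nat.card (Iso T T) :=
  have : Nonempty (Iso T T) := ⟨Iso.refl T⟩
  Nat.card_pos

theorem cls_eq_iff {S T : OpTree} : S.cls = T.cls ↔ Nonempty (Iso S T) := Quotient.eq

open Classical in
-- If nonempty, the set of isomorphisms is a torsor under `Aut S`.
theorem card_iso (S T : OpTree) :
    Nat.card (Iso S T) = if S.cls = T.cls then Nat.card (Iso S S) else 0 := by
  split_ifs with h
  · obtain ⟨g⟩ := cls_eq_iff.1 h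
    exact Nat.card_congr
      { toFun := fun f => f.trans g.symm
        invFun := fun f => f.trans g
        left_inv := fun f => Iso.ext_edge fun x => g.edge.apply_symm_apply _
        right_inv := fun f => Iso.ext_edge fun x => g.edge.symm_apply_apply _ }
  · have : IsEmpty (Iso S T) := ⟨fun g => h (cls_eq g)⟩
    exact Nat.card_of_isEmpty

@[simp] theorem cls_out (τ : TreeClass) : OpTree.cls (Quotient.out τ) = τ := Quotient.out_eq τ

theorem autCard_cls (T : OpTree) : T.cls.autCard = Nat.card (Iso T T) := rfl

theorem card_iso_out_self (τ : TreeClass) : Nat.card (Iso τ.out τ.out) = τ.autCard := by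
  rw [← autCard_cls, cls_out]

end OpTree

open OpTree

theorem TreeClass.autCard_ne_zero (τ : TreeClass) : (τ.autCard : ℚ) ≠ 0 := by
  rw [← card_iso_out_self]
  exact Nat.cast_ne_zero.2 (card_iso_self_pos _).ne'

/-! ### Coefficients of linear series and their powers -/

namespace TreeSeries

theorem coeff_linear_single (a : TreeClass → ℚ) (τ : TreeClass) :
    MvPowerSeries.coeff (Finsupp.single τ 1) (linear a) = a τ := by
  change (∑ σ ∈ (Finsupp.single τ 1).support, _) = a τ
  rw [Finsupp.support_single _ one_ne_zero, Finset.sum_singleton, if_pos rfl]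

theorem coeff_linear_of_ne (a : TreeClass → ℚ) {d : TreeClass →₀ ℕ}
    (hd : ∀ τ, d ≠ Finsupp.single τ 1) : MvPowerSeries.coeff d (linear a) = 0 :=
  Finset.sum_eq_zero fun τ _ => if_neg (hd τ)

theorem single_one_injective :
    Function.Injective fun τ : TreeClass => (Finsupp.single τ 1 : TreeClass →₀ ℕ) :=
  Finsupp.single_left_injective one_ne_zero

open Classical in
/-- The ways of labelling a finite set by tree classes such that the resulting forest is `d`. -/
noncomputable def labellings (ι : Type) [Fintype ι] (d : TreeClass →₀ ℕ) :
    Finset (ι → TreeClass) :=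
  (Fintype.piFinset fun _ => d.support).filter fun f => ∑ i, Finsupp.single (f i) 1 = d

/-- Restricting the labels to the support of `d` only serves finiteness: every label used occurs in
the sum. -/
theorem mem_labellings {ι : Type} [Fintype ι] {d : TreeClass →₀ ℕ} {f : ι → TreeClass} :
    f ∈ labellings ι d ↔ ∑ i, Finsupp.single (f i) 1 = d := by
  classical
  rw [labellings, Finset.mem_filter, and_iff_right_iff_imp]
  rintro rfl
  refine Fintype.mem_piFinset.2 fun i => ?_
  rw [Finsupp.mem_support_iff, Finsupp.finsetSum_apply]
  refine (Finset.sum_pos' (fun _ _ => Nat.zero_le _) ⟨i, Finset.mem_univ i, ?_⟩).ne'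
  rw [Finsupp.single_eq_same]
  exact one_pos

/-- Expanding the product, each factor must contribute one variable, which is a labelling of the
factors. Indexing them by `ι` lets the leaves of a tree serve as factors. -/
theorem coeff_linear_pow (ι : Type) [Fintype ι] (a : TreeClass → ℚ) (d : TreeClass →₀ ℕ) :
    MvPowerSeries.coeff d (linear a ^ Fintype.card ι) = ∑ f ∈ labellings ι d, ∏ i, a (f i) := by
  classical
  rw [← Finset.card_univ, ← Finset.prod_const, MvPowerSeries.coeff_prod]
  symm
  refine Finset.sum_of_injOn
    (fun f => Finsupp.equivFunOnFinite.symm fun i => Finsupp.single (f i) 1) ?_ ?_ ?_ ?_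
  · intro f _ g _ h
    exact funext fun i => single_one_injective (DFunLike.congr_fun h i)
  · intro f hf
    exact Finset.mem_coe.2 (Finset.mem_finsuppAntidiag.2 ⟨mem_labellings.1 hf, Finset.subset_univ _⟩)
  · intro h hh hne
    by_cases hs : ∀ i, ∃ τ, h i = Finsupp.single τ 1
    · choose f hf using hs
      refine absurd ⟨f, Finset.mem_coe.2 (mem_labellings.2 ?_), ?_⟩ hne
      · rw [← (Finset.mem_finsuppAntidiag.1 hh).1]
        exact Finset.sum_congr rfl fun i _ => (hf i).symm
      · ext1 i
        exact (hf i).symm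
    · push Not at hs
      obtain ⟨i, hi⟩ := hs
      exact Finset.prod_eq_zero (Finset.mem_univ i) (coeff_linear_of_ne a hi)
  · intro f _
    exact Finset.prod_congr rfl fun i _ => (coeff_linear_single a (f i)).symm

end TreeSeries

/-! ### The double count -/

namespace OpTree

open TreeSeries

/-- The exponent of the monomial given by the forest of a cut. -/
noncomputable def Cut.exponent {T : OpTree} (c : T.Cut) : TreeClass →₀ ℕ :=
  ∑ l : c.toTree.Leaf, Finsupp.single (T.ideal (c.leafEdge l)).cls 1

theorem Cut.forest_eq {T : OpTree} (c : T.Cut) :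
    c.forest = MvPolynomial.monomial c.exponent 1 :=
  (MvPolynomial.monomial_sum_one _ _).symm

open Classical in
theorem sum_inv_mul_card_iso_graft (S T : OpTree) (d : TreeClass →₀ ℕ) :
    ∑ f ∈ labellings S.Leaf d, (∏ l, 1 / ((f l).autCard : ℚ)) *
        (Nat.card (Iso (S.graft fun l => (f l).out) T) : ℚ) =
      ((Finset.univ.filter fun c : T.Cut => c.exponent = d ∧ c.toTree.cls = S.cls).card : ℚ) *
        (S.cls.autCard : ℚ) := by
  -- Only the labelling by the classes of the ideal subtrees gives a nonzero product, and there each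
  -- isomorphism count cancels `1/|Aut|`.
  have key : ∀ (c : T.Cut) (φ : Iso S c.toTree),
      ∑ f ∈ labellings S.Leaf d, (∏ l, 1 / ((f l).autCard : ℚ)) *
        ∏ l, (Nat.card (Iso (f l).out (T.ideal (c.leafEdge (φ.leaf l)))) : ℚ) =
      if c.exponent = d then 1 else 0 := by
    intro c φ
    have hg : c.exponent = d ↔
        (fun l => (T.ideal (c.leafEdge (φ.leaf l))).cls) ∈ labellings S.Leaf d := by
      rw [mem_labellings, Cut.exponent]
      exact Eq.congr_left (Fintype.sum_equiv φ.leaf _ _ fun _ => rfl).symm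
    simp only [hg]
    rw [← Finset.sum_ite_eq' (labellings S.Leaf d) _ fun _ => (1 : ℚ)]
    refine Finset.sum_congr rfl fun f _ => ?_
    rw [← Finset.prod_mul_distrib]
    split_ifs with hf
    · refine Finset.prod_eq_one fun l _ => ?_
      rw [card_iso, cls_out, card_iso_out_self, if_pos (congrFun hf l)]
      exact one_div_mul_cancel (TreeClass.autCard_ne_zero _)
    · obtain ⟨l, hl⟩ := Function.ne_iff.1 hf
      refine Finset.prod_eq_zero (Finset.mem_univ l) ?_
      rw [card_iso, cls_out, if_neg hl, Nat.cast_zero, mul_zero]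
  have hc : ∀ f : S.Leaf → TreeClass, (Nat.card (Iso (S.graft fun l => (f l).out) T) : ℚ) =
      ∑ c : T.Cut, ∑ φ : Iso S c.toTree,
        ∏ l, (Nat.card (Iso (f l).out (T.ideal (c.leafEdge (φ.leaf l)))) : ℚ) := by
    intro f
    rw [card_iso_graft, Nat.card_sigma, Nat.cast_sum]
    refine Finset.sum_congr rfl fun c _ => ?_
    rw [Nat.card_sigma, Nat.cast_sum]
    refine Finset.sum_congr rfl fun φ _ => ?_
    rw [Nat.card_pi, Nat.cast_prod]
  simp only [hc, Finset.mul_sum]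
  rw [Finset.sum_comm]
  simp only [Finset.sum_comm (s := labellings S.Leaf d), key]
  rw [Finset.card_filter, Nat.cast_sum, Finset.sum_mul]
  refine Finset.sum_congr rfl fun c _ => ?_
  -- The summand no longer depends on `φ`, so the inner sum counts isomorphisms from `S` to `S_c`.
  rw [Finset.sum_const, Finset.card_univ, ← Nat.card_eq_fintype_card, card_iso, autCard_cls]
  by_cases h1 : c.exponent = d <;> by_cases h2 : S.cls = c.toTree.cls <;>
    simp [h1, h2, eq_comm]

end OpTree

/-! ### Coefficients of the comultiplication and substitution -/

open TreeSeries

theorem toTreeSeries₂_monomial_tmul (d e : TreeClass →₀ ℕ) :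
    toTreeSeries₂ (MvPolynomial.monomial d 1 ⊗ₜ[ℚ] MvPolynomial.monomial e 1) =
      MvPowerSeries.monomial (Finsupp.sumFinsuppEquivProdFinsupp.symm (d, e)) 1 := by
  have h : Finsupp.mapDomain Sum.inl d + Finsupp.mapDomain Sum.inr e =
      Finsupp.sumFinsuppEquivProdFinsupp.symm (d, e) := by
    ext (x | x)
    · rw [Finsupp.add_apply, Finsupp.mapDomain_apply Sum.inl_injective,
        Finsupp.mapDomain_of_notMem_range e (Sum.inl x) (by simp), add_zero]
      rfl
    · rw [Finsupp.add_apply, Finsupp.mapDomain_apply Sum.inr_injective,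
        Finsupp.mapDomain_of_notMem_range d (Sum.inr x) (by simp), zero_add]
      rfl
  rw [toTreeSeries₂, AlgHom.comp_apply, Algebra.TensorProduct.productMap_apply_tmul,
    MvPolynomial.rename_monomial, MvPolynomial.rename_monomial, MvPolynomial.monomial_mul,
    mul_one, h]
  exact MvPolynomial.coe_monomial _ _

open Classical in
theorem coeff_comul_cls (T : OpTree) (e : TreeClass ⊕ TreeClass →₀ ℕ) :
    MvPowerSeries.coeff e (toTreeSeries₂ (treeComul (MvPolynomial.X T.cls))) =
      ((Finset.univ.filter fun c : T.Cut =>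
        c.exponent = (Finsupp.sumFinsuppEquivProdFinsupp e).1 ∧
        Finsupp.single c.toTree.cls 1 = (Finsupp.sumFinsuppEquivProdFinsupp e).2).card : ℚ) := by
  have h : treeComul (MvPolynomial.X T.cls) = T.comulTree := MvPolynomial.aeval_X _ _
  rw [h, OpTree.comulTree, map_sum, map_sum, Finset.card_filter, Nat.cast_sum]
  refine Finset.sum_congr rfl fun c _ => ?_
  rw [c.forest_eq, MvPolynomial.X, toTreeSeries₂_monomial_tmul, MvPowerSeries.coeff_monomial,
    Nat.cast_ite, Nat.cast_one, Nat.cast_zero]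
  refine if_congr ?_ rfl rfl
  rw [← Equiv.apply_eq_iff_eq Finsupp.sumFinsuppEquivProdFinsupp, Equiv.apply_symm_apply,
    Prod.ext_iff, eq_comm, @eq_comm _ _ (Finsupp.single _ 1)]

theorem coeff_comul_of_ne (τ : TreeClass) {e : TreeClass ⊕ TreeClass →₀ ℕ}
    (he : ∀ σ, (Finsupp.sumFinsuppEquivProdFinsupp e).2 ≠ Finsupp.single σ 1) :
    MvPowerSeries.coeff e (toTreeSeries₂ (treeComul (MvPolynomial.X τ))) = 0 := by
  classical
  rw [← cls_out τ, coeff_comul_cls, Finset.filter_false_of_mem fun c _ h => he _ h.2.symm,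
    Finset.card_empty, Nat.cast_zero]

open Classical in
-- The double count divided by both automorphism orders. On the right `τ` survives only in the test,
-- so summing over `τ` becomes trivial.
theorem inv_mul_coeff_comul (S : OpTree) {e : TreeClass ⊕ TreeClass →₀ ℕ}
    (he : (Finsupp.sumFinsuppEquivProdFinsupp e).2 = Finsupp.single S.cls 1) (τ : TreeClass) :
    1 / (τ.autCard : ℚ) *
        MvPowerSeries.coeff e (toTreeSeries₂ (treeComul (MvPolynomial.X τ))) =
      ∑ f ∈ labellings S.Leaf (Finsupp.sumFinsuppEquivProdFinsupp e).1,
        if (S.graft fun l => (f l).out).cls = τ then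
          1 / (S.cls.autCard : ℚ) * ∏ l, 1 / ((f l).autCard : ℚ) else 0 := by
  have h := sum_inv_mul_card_iso_graft S τ.out (Finsupp.sumFinsuppEquivProdFinsupp e).1
  have hS := S.cls.autCard_ne_zero
  have hτ := τ.autCard_ne_zero
  have h' := coeff_comul_cls τ.out e
  rw [cls_out] at h'
  simp only [he, single_one_injective.eq_iff] at h'
  rw [h', eq_div_of_mul_eq hS h.symm, mul_div_assoc', Finset.mul_sum, Finset.sum_div]
  refine Finset.sum_congr rfl fun f _ => ?_
  rw [card_iso, cls_out]
  split_ifs with hf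
  · rw [← autCard_cls, hf]
    field_simp
  · simp

theorem hasSubst_comul : MvPowerSeries.HasSubst
    (fun τ : TreeClass => toTreeSeries₂ (treeComul (MvPolynomial.X τ))) where
  const_coeff τ := by
    rw [← MvPowerSeries.coeff_zero_eq_constantCoeff_apply, coeff_comul_of_ne]
    · exact IsNilpotent.zero
    · intro σ h
      exact one_ne_zero (Finsupp.single_eq_zero.1 (h.symm.trans (Finsupp.comapDomain_zero _)))
  coeff_zero e := by
    classical
    by_cases he : ∃ σ, (Finsupp.sumFinsuppEquivProdFinsupp e).2 = Finsupp.single σ 1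
    · obtain ⟨σ, he⟩ := he
      rw [← cls_out σ] at he
      -- A tree contributing to this coefficient is a grafting along one of finitely many
      -- labellings.
      refine Set.Finite.subset (Finset.finite_toSet
        ((labellings (Quotient.out σ).Leaf (Finsupp.sumFinsuppEquivProdFinsupp e).1).image
          fun f => ((Quotient.out σ).graft fun l => (f l).out).cls)) fun τ hτ => ?_
      have hne := mul_ne_zero (one_div_ne_zero τ.autCard_ne_zero) hτ
      rw [inv_mul_coeff_comul _ he] at hne
      obtain ⟨f, hf, hfτ⟩ := Finset.exists_ne_zero_of_sum_ne_zero hne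
      exact Finset.mem_coe.2 (Finset.mem_image.2 ⟨f, hf, (ite_ne_right_iff.1 hfτ).1⟩)
    · push Not at he
      convert Set.finite_empty
      exact Set.eq_empty_iff_forall_notMem.2 fun τ hτ => hτ (coeff_comul_of_ne τ he)

/-- In the substitution formula only exponents of single variables survive, and these are indexed by
tree classes. -/
theorem TreeSeries.coeff_comul_linear (a : TreeClass → ℚ) (e : TreeClass ⊕ TreeClass →₀ ℕ) :
    MvPowerSeries.coeff e (TreeSeries.comul (linear a)) =
      ∑ᶠ τ, a τ * MvPowerSeries.coeff e (toTreeSeries₂ (treeComul (MvPolynomial.X τ))) := by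
  rw [TreeSeries.comul, MvPowerSeries.coeff_subst hasSubst_comul, ← finsum_mem_univ]
  rw [finsum_mem_inter_support_eq' (t := Set.range fun τ => Finsupp.single τ 1),
    finsum_mem_range single_one_injective]
  · refine finsum_congr fun τ => ?_
    rw [coeff_linear_single, Finsupp.prod_single_index, pow_one, smul_eq_mul]
    exact pow_zero _
  · intro d hd
    refine iff_of_true (Set.mem_univ d) ?_
    by_contra hne
    refine hd ?_
    dsimp only
    rw [coeff_linear_of_ne a fun τ h => hne ⟨τ, h.symm⟩, zero_smul]

theorem coeff_comul_greenFunction (S : OpTree) {e : TreeClass ⊕ TreeClass →₀ ℕ}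
    (he : (Finsupp.sumFinsuppEquivProdFinsupp e).2 = Finsupp.single S.cls 1) :
    MvPowerSeries.coeff e (TreeSeries.comul greenFunction) =
      MvPowerSeries.coeff (Finsupp.sumFinsuppEquivProdFinsupp e).1
        (greenFunction ^ S.cls.numLeaves) * (1 / (S.cls.autCard : ℚ)) := by
  classical
  have hn : S.cls.numLeaves = Fintype.card S.Leaf := Nat.card_eq_fintype_card
  rw [hn, greenFunction, coeff_linear_pow, coeff_comul_linear,
    finsum_congr (inv_mul_coeff_comul S he), finsum_sum_comm, Finset.sum_mul]
  · refine Finset.sum_congr rfl fun f _ => ?_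
    -- Each labelling is counted for exactly one `τ`, the class of its grafting.
    rw [finsum_eq_single _ (S.graft fun l => (f l).out).cls fun τ hτ => if_neg hτ.symm,
      if_pos rfl, mul_comm]
  · intro f _
    refine (Set.finite_singleton (S.graft fun l => (f l).out).cls).subset fun τ hτ => ?_
    exact (ite_ne_right_iff.1 hτ).1.symm

/-! ### Summation over the number of leaves -/

theorem coeff_tensor_greenSummand_of_ne (f : TreeSeries) (n : ℕ)
    {e : TreeClass ⊕ TreeClass →₀ ℕ} (he : ∀ σ, (Finsupp.sumFinsuppEquivProdFinsupp e).2 =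
      Finsupp.single σ 1 → n ≠ σ.numLeaves) :
    MvPowerSeries.coeff e (TreeSeries.tensor f (greenSummand n)) = 0 := by
  refine mul_eq_zero_of_right _ ?_
  by_cases h : ∃ σ, (Finsupp.sumFinsuppEquivProdFinsupp e).2 = Finsupp.single σ 1
  · obtain ⟨σ, hσ⟩ := h
    rw [hσ, greenSummand, coeff_linear_single, if_neg (he σ hσ).symm]
  · push Not at h
    exact coeff_linear_of_ne _ h

/-- Suited to sums graded by leaf number, where a monomial occurs in at most one summand. -/
theorem isFormalSum_of_eq_single {ι σ : Type*} {f : ι → MvPowerSeries σ ℚ}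
    {F : MvPowerSeries σ ℚ}
    (h : ∀ d, ∃ i, MvPowerSeries.coeff d F = MvPowerSeries.coeff d (f i) ∧
      ∀ j, j ≠ i → MvPowerSeries.coeff d (f j) = 0) : IsFormalSum f F := by
  intro d
  obtain ⟨i, hi, hj⟩ := h d
  refine ⟨(Set.finite_singleton i).subset fun j hne => ?_, ?_⟩
  · by_contra hji
    exact hne (hj j hji)
  · rw [finsum_eq_single _ i hj, hi]

theorem isFormalSum_greenSummand : IsFormalSum greenSummand greenFunction := by
  refine isFormalSum_of_eq_single fun d => ?_
  by_cases h : ∃ σ, d = Finsupp.single σ 1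
  · obtain ⟨σ, rfl⟩ := h
    refine ⟨σ.numLeaves, ?_, fun n hn => ?_⟩
    · rw [greenFunction, greenSummand, coeff_linear_single, coeff_linear_single, if_pos rfl]
    · rw [greenSummand, coeff_linear_single, if_neg hn.symm]
  · push Not at h
    exact ⟨0, by rw [greenFunction, greenSummand, coeff_linear_of_ne _ h, coeff_linear_of_ne _ h],
      fun n _ => coeff_linear_of_ne _ h⟩

theorem isFormalSum_tensor_greenSummand :
    IsFormalSum (fun n : ℕ => TreeSeries.tensor (greenFunction ^ n) (greenSummand n))
      (TreeSeries.comul greenFunction) := by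
  refine isFormalSum_of_eq_single fun e => ?_
  by_cases h : ∃ σ, (Finsupp.sumFinsuppEquivProdFinsupp e).2 = Finsupp.single σ 1
  · obtain ⟨σ, hσ⟩ := h
    refine ⟨σ.numLeaves, ?_, fun n hn => coeff_tensor_greenSummand_of_ne _ _ fun σ' hσ' => ?_⟩
    · have h2 : MvPowerSeries.coeff (Finsupp.sumFinsuppEquivProdFinsupp e).2
          (greenSummand σ.numLeaves) = 1 / (σ.autCard : ℚ) := by
        rw [hσ, greenSummand, coeff_linear_single, if_pos rfl]
      rw [← cls_out σ] at hσ
      have h1 := coeff_comul_greenFunction σ.out hσ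
      rw [cls_out, ← h2] at h1
      exact h1
    · rwa [single_one_injective (hσ'.symm.trans hσ)]
  · push Not at h
    -- The index 0 is arbitrary: without a single tree on the right, all coefficients vanish.
    refine ⟨0, ?_, fun n _ => coeff_tensor_greenSummand_of_ne _ _ fun σ hσ => absurd hσ (h σ)⟩
    rw [coeff_tensor_greenSummand_of_ne _ _ fun σ hσ => absurd hσ (h σ), greenFunction,
      coeff_comul_linear]
    exact finsum_eq_zero_of_forall_eq_zero fun τ => by rw [coeff_comul_of_ne τ h, mul_zero]

/-- Both sides are algebra homomorphisms in `q` that agree on the variables. -/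
theorem TreeSeries.comul_coe (q : TreeAlg) :
    TreeSeries.comul (q : TreeSeries) = toTreeSeries₂ (treeComul q) := by
  rw [TreeSeries.comul, MvPowerSeries.subst_coe]
  refine DFunLike.congr_fun (?_ : MvPolynomial.aeval _ = toTreeSeries₂.comp treeComul) q
  refine MvPolynomial.algHom_ext fun τ => ?_
  rw [MvPolynomial.aeval_X, AlgHom.comp_apply]

theorem mainTheorem5 :
    -- the comultiplication extends (continuously) from polynomials to power series
    MvPowerSeries.HasSubst
        (fun τ : TreeClass => toTreeSeries₂ (treeComul (MvPolynomial.X τ))) ∧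
    (∀ q : TreeAlg, TreeSeries.comul (q : TreeSeries) = toTreeSeries₂ (treeComul q)) ∧
    -- `G = ∑ n, g_n`
    IsFormalSum greenSummand greenFunction ∧
    -- `Δ(G) = ∑ n, G ^ n ⊗ g_n`
    IsFormalSum (fun n : ℕ => TreeSeries.tensor (greenFunction ^ n) (greenSummand n))
      (TreeSeries.comul greenFunction) :=
  ⟨hasSubst_comul, TreeSeries.comul_coe, isFormalSum_greenSummand,
    isFormalSum_tensor_greenSummand⟩
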